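/- For $x\in\mathbb{C}$ put $\mathrm{e}(x)=e^{2\pi i x}$. For $\tau\in\mathbb{C}$ with $\operatorname{im}\tau>0$ let $q=\mathrm{e}(\tau)$, let $$\theta_\tau(\upsilon)=\frac1i\sum_{m\in\mathbb{Z}}(-1)^m e^{\pi i\tau(m+\frac12)^2}\,\mathrm{e}\!\left(\tfrac{(2m+1)\upsilon}2\right)$$ be the Jacobi theta function, and define $$\Delta_\tau(a,b)=\frac{\theta_\tau'(0)\,\theta_\tau(a+b)}{\theta_\tau(a)\,\theta_\tau(b)},\qquad \delta(\mathrm{e}(a),\mathrm{e}(b))=\frac1{2\pi i}\Delta_\tau(a,b);$$ $\delta$ is a well-defined meromorphic function on $\mathbb{C}^*\times\mathbb{C}^*$. **Corollary.** Let $n>0$ be a natural number. Then, as meromorphic functions of $t_1,t_2,\mu_1,\mu_2\in\mathbb{C}^*$ (and $\tau$), $$\sum_{k=0}^{n-1}\sum_{\ell=0}^{n-1}\Big(\frac{\mu_2}{\mu_1}\Big)^{\ell}\,\delta\Big(\mathrm{e}\big(\tfrac{k-\ell\tau}n\big)t_1,\mu_1^n\Big)\,\delta\Big(\mathrm{e}\big(\tfrac{\tau\ell-k}n\big)t_2,\mu_2^n\Big)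 =-\sum_{k=0}^{n-1}\sum_{\ell=0}^{n-1}(t_1t_2)^{-\ell}\,\delta\Big(\mathrm{e}\big(\tfrac{k-\ell\tau}n\big)\mu_1,t_1^n\Big)\,\delta\Big(\mathrm{e}\big(\tfrac{\tau\ell-k}n\big)\mu_2^{-1},t_2^{-n}\Big).$$ That is, the equality holds for all $\tau$ with $\operatorname{im}\tau>0$ and all $t_1,t_2,\mu_1,\mu_2\in\mathbb{C}^*$ at which no factor $\delta$ has a vanishing denominator, i.e. such that none of $t_1^n,t_2^n,\mu_1^n,\mu_2^n$ is an integral power of $q$. -/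

import Mathlib

namespace EllTheta

/-- The exponential `e(x) = exp(2πi x)`. -/
noncomputable def e (x : ℂ) : ℂ := Complex.exp (2 * Real.pi * Complex.I * x)

/-- The Jacobi theta function
`θ_τ(υ) = (1/i) ∑_{n ∈ ℤ} (-1)^n q₀^{(n+1/2)^2} e((2n+1)υ/2)`, where `q₀ = e(τ/2)`
and `q₀^s` means `e(sτ/2)`. The series converges absolutely if `0 < im τ`. -/
noncomputable def theta (τ υ : ℂ) : ℂ :=
  1 / Complex.I *
    ∑' n : ℤ, (-1 : ℂ) ^ n * e (((n : ℂ) + 1 / 2) ^ 2 * (τ / 2)) * e ((2 * (n : ℂ) + 1) * υ / 2)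

/-- `Δ_τ(a, b) = θ_τ'(0) θ_τ(a + b) / (θ_τ(a) θ_τ(b))`. -/
noncomputable def Del (τ a b : ℂ) : ℂ :=
  deriv (theta τ) 0 * theta τ (a + b) / (theta τ a * theta τ b)

/-- The multiplicative form of `Δ_τ`: `δ_τ(A, B) = (1/(2πi)) Δ_τ(a, b)` where `A = e(a)`,
`B = e(b)`. The logarithms `a`, `b` are taken on the principal branch; by `delta_e` below any
other choice gives the same value. -/
noncomputable def delta (τ A B : ℂ) : ℂ :=
  1 / (2 * Real.pi * Complex.I) *
    Del τ (Complex.log A / (2 * Real.pi * Complex.I)) (Complex.log B / (2 * Real.pi * Complex.I))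

theorem theta_add_one (τ υ : ℂ) : theta τ (υ + 1) = -theta τ υ := by
  unfold theta
  rw [← mul_neg, ← tsum_neg]
  congr 2
  funext n
  have h : e ((2 * (n : ℂ) + 1) * (υ + 1) / 2) = -e ((2 * (n : ℂ) + 1) * υ / 2) := by
    unfold e
    have : 2 * (Real.pi : ℂ) * Complex.I * ((2 * (n : ℂ) + 1) * (υ + 1) / 2)
        = 2 * (Real.pi : ℂ) * Complex.I * ((2 * (n : ℂ) + 1) * υ / 2)
          + (n * (2 * (Real.pi : ℂ) * Complex.I) + Real.pi * Complex.I) := by ring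
    rw [this, Complex.exp_add, Complex.exp_add, Complex.exp_int_mul_two_pi_mul_I,
      Complex.exp_pi_mul_I]
    ring
  rw [h]
  ring

theorem Del_add_one_left (τ a b : ℂ) : Del τ (a + 1) b = Del τ a b := by
  unfold Del
  rw [show a + 1 + b = a + b + 1 by ring, theta_add_one, theta_add_one, mul_neg, neg_mul,
    neg_div_neg_eq]

theorem Del_symm (τ a b : ℂ) : Del τ a b = Del τ b a := by
  unfold Del
  rw [add_comm a b, mul_comm (theta τ a)]

theorem Del_add_int_left (τ a b : ℂ) (m : ℤ) : Del τ (a + m) b = Del τ a b := by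
  have h : Function.Periodic (fun x => Del τ x b) 1 := fun x => Del_add_one_left τ x b
  simpa using h.int_mul m a

theorem log_e (a : ℂ) :
    ∃ m : ℤ, Complex.log (e a) / (2 * Real.pi * Complex.I) = a + m := by
  have h0 : (2 * (Real.pi : ℂ) * Complex.I) ≠ 0 := Complex.two_pi_I_ne_zero
  have h : Complex.exp (Complex.log (e a)) = Complex.exp (2 * Real.pi * Complex.I * a) :=
    Complex.exp_log (Complex.exp_ne_zero _)
  obtain ⟨m, hm⟩ := Complex.exp_eq_exp_iff_exists_int.mp h
  refine ⟨m, ?_⟩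
  rw [hm]
  field_simp

/-- `δ_τ(e(a), e(b)) = (1/(2πi)) Δ_τ(a, b)` for all complex `a`, `b`. -/
theorem delta_e (τ a b : ℂ) :
    delta τ (e a) (e b) = 1 / (2 * Real.pi * Complex.I) * Del τ a b := by
  obtain ⟨m, hm⟩ := log_e a
  obtain ⟨k, hk⟩ := log_e b
  unfold delta
  rw [hm, hk, Del_add_int_left, Del_symm, Del_add_int_left, Del_symm]

end EllTheta

/-! Write `t₁ = e a₁`, `μ₁ = e b₁` and so on. The Kronecker function `Del τ a w`, as a function of
`w`, has period 1, multiplier `e (-a)` under `w ↦ w + τ`, and only simple poles, at lattice points,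
with residue 1 at 0. A function with removable singularities and a multiplier that is no power of
`q` is zero, so these data determine it. The average over `n`-torsion points in
`Del_eq_sum_torsionTerm` has the same data, hence equals `Del τ a w`.

Translating `a` by a torsion point turns this expansion into a Fourier transform on `(ℤ/n)²` for the
symplectic character `e ((k' * l - k * l') / n)` (`Del_torsion_eq_sum`). The two factors of a
summand on the left are such transforms at opposite points, up to exponentials that the weight
`(μ₂/μ₁)^l` cancels. `symplectic_parseval` then replaces the double sum by that of the untransformed
functions, and the oddness `Del_neg` gives the minus sign.

The analytic input is that theta vanishes exactly on the lattice, to first order at 0. This comes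
from the Jacobi triple product up to a constant, itself an application of Liouville's theorem on the
torus. -/

namespace EllTheta

open Filter Topology Complex

/-! ### The lattice and Liouville's theorem on the torus -/

/-- The lattice `ℤ + ℤ τ`. -/
def lattice (τ : ℂ) : AddSubgroup ℂ where
  carrier := {z | ∃ m k : ℤ, z = m + k * τ}
  zero_mem' := ⟨0, 0, by simp⟩
  add_mem' := by
    rintro _ _ ⟨m, k, rfl⟩ ⟨m', k', rfl⟩
    exact ⟨m + m', k + k', by push_cast; ring⟩
  neg_mem' := by
    rintro _ ⟨m, k, rfl⟩
    exact ⟨-m, -k, by push_cast; ring⟩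

theorem mem_lattice {τ z : ℂ} : z ∈ lattice τ ↔ ∃ m k : ℤ, z = m + k * τ := Iff.rfl

theorem one_mem_lattice (τ : ℂ) : (1 : ℂ) ∈ lattice τ := ⟨1, 0, by simp⟩

theorem self_mem_lattice (τ : ℂ) : τ ∈ lattice τ := ⟨0, 1, by simp⟩

theorem eq_zero_of_mem_lattice {τ z : ℂ} (hz : z ∈ lattice τ) (hτ : 0 < τ.im)
    (h1 : ‖z‖ < 1) (h2 : ‖z‖ < τ.im) : z = 0 := by
  obtain ⟨m, k, rfl⟩ := hz
  have him := (abs_im_le_norm _).trans_lt h2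
  have hk : k = 0 := by
    simp only [add_im, intCast_im, mul_im, intCast_re, zero_mul, add_zero, zero_add, abs_mul,
      abs_of_pos hτ] at him
    have : |(k : ℝ)| < 1 := by nlinarith
    exact Int.abs_lt_one_iff.mp (by exact_mod_cast this)
  subst hk
  have hm : |(m : ℝ)| < 1 := by simpa using h1
  have : m = 0 := Int.abs_lt_one_iff.mp (by exact_mod_cast hm)
  simp [this]

/-- Distinct lattice points are at distance at least `min 1 τ.im`. Arbitrary subsets are allowed so
that one point can be removed from the lattice. -/
theorem isClosed_of_subset_lattice {τ : ℂ} (hτ : 0 < τ.im) {s : Set ℂ}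
    (hs : s ⊆ lattice τ) : IsClosed s := by
  refine Metric.isClosed_of_pairwise_le_dist (ε := min 1 τ.im) (by positivity) ?_
  intro x hx y hy hxy
  by_contra! h
  rw [lt_min_iff, dist_eq_norm] at h
  exact hxy (sub_eq_zero.mp
    (eq_zero_of_mem_lattice ((lattice τ).sub_mem (hs hx) (hs hy)) hτ h.1 h.2))

theorem eventually_notMem_lattice {τ : ℂ} (hτ : 0 < τ.im) (p : ℂ) :
    ∀ᶠ z in 𝓝[≠] p, z ∉ lattice τ := by
  have h : ((lattice τ : Set ℂ) \ {p})ᶜ ∈ 𝓝 p :=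
    (isClosed_of_subset_lattice hτ Set.sdiff_subset).isOpen_compl.mem_nhds (by simp)
  filter_upwards [mem_nhdsWithin_of_mem_nhds h, self_mem_nhdsWithin] with z hz hz' hzl
  exact hz ⟨hzl, hz'⟩

theorem exists_lattice_norm_sub_le {τ : ℂ} (hτ : 0 < τ.im) (z : ℂ) :
    ∃ s ∈ lattice τ, ‖z - s‖ ≤ 1 + ‖τ‖ := by
  set y : ℝ := z.im / τ.im with hy
  set x : ℝ := z.re - y * τ.re with hx
  have hz : z = x + y * τ := by
    apply Complex.ext
    · simp [hx]
    · simp [hy, hτ.ne']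
  refine ⟨⌊x⌋ + ⌊y⌋ * τ, ⟨_, _, rfl⟩, ?_⟩
  have h : z - (⌊x⌋ + ⌊y⌋ * τ) = (Int.fract x : ℝ) + (Int.fract y : ℝ) * τ := by
    rw [hz, Int.fract, Int.fract]; push_cast; ring
  rw [h]
  refine (norm_add_le _ _).trans ?_
  rw [norm_mul, norm_real, norm_real, Real.norm_of_nonneg (Int.fract_nonneg _),
    Real.norm_of_nonneg (Int.fract_nonneg _)]
  have h1 := (Int.fract_lt_one x).le
  have h2 := (Int.fract_lt_one y).le
  nlinarith [norm_nonneg τ]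

theorem eq_of_periodic_of_mem_lattice {α : Type*} {τ : ℂ} {f : ℂ → α}
    (h1 : ∀ z, f (z + 1) = f z) (h2 : ∀ z, f (z + τ) = f z) {s : ℂ} (hs : s ∈ lattice τ) (z : ℂ) :
    f (z + s) = f z := by
  obtain ⟨m, k, rfl⟩ := hs
  have e1 : Function.Periodic f 1 := h1
  have e2 : Function.Periodic f τ := h2
  rw [← add_assoc, e2.int_mul k, ← mul_one (m : ℂ), e1.int_mul m]

/-- **Liouville's theorem for the torus**: a function holomorphic off the lattice, of doubly
periodic norm, and with removable singularities is constant. -/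
theorem exists_const_of_norm_periodic {τ : ℂ} (hτ : 0 < τ.im) {f : ℂ → ℂ}
    (hf : ∀ z ∉ lattice τ, DifferentiableAt ℂ f z)
    (h1 : ∀ z, ‖f (z + 1)‖ = ‖f z‖) (h2 : ∀ z, ‖f (z + τ)‖ = ‖f z‖)
    (h0 : Tendsto (fun z => z * f z) (𝓝[≠] 0) (𝓝 0)) :
    ∃ C, ∀ z ∉ lattice τ, f z = C := by
  have hper : ∀ s ∈ lattice τ, ∀ z, ‖f (z + s)‖ = ‖f z‖ := fun s hs z =>
    eq_of_periodic_of_mem_lattice (f := fun z => ‖f z‖) h1 h2 hs z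
  have hlim : ∀ p, Tendsto (fun z => (z - p) * f z) (𝓝[≠] p) (𝓝 0) := by
    intro p
    by_cases hp : p ∈ lattice τ
    · have ht : Tendsto (fun z => z - p) (𝓝[≠] p) (𝓝[≠] 0) := by
        refine tendsto_nhdsWithin_iff.mpr ⟨?_, ?_⟩
        · have : ContinuousAt (fun z => z - p) p := by fun_prop
          simpa using this.tendsto.mono_left nhdsWithin_le_nhds
        · filter_upwards [self_mem_nhdsWithin] with z hz
          simpa [sub_eq_zero] using hz
      rw [tendsto_zero_iff_norm_tendsto_zero] at h0 ⊢
      refine (h0.comp ht).congr fun z => ?_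
      simp only [Function.comp_apply, norm_mul]
      rw [← hper p hp (z - p), sub_add_cancel]
    · have : ContinuousAt (fun z => (z - p) * f z) p := by
        have := (hf p hp).continuousAt
        fun_prop
      simpa using this.tendsto.mono_left nhdsWithin_le_nhds
  -- The values of `f` at lattice points carry no information. Taking limits there gives an entire
  -- function, by Riemann's removable singularity theorem and `hlim`.
  set g : ℂ → ℂ := fun z => limUnder (𝓝[≠] z) f with hg
  have hgf : ∀ z ∉ lattice τ, g z = f z := fun z hz =>
    ((hf z hz).continuousAt.tendsto.mono_left nhdsWithin_le_nhds).limUnder_eq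
  have hgd : Differentiable ℂ g := by
    intro p
    have hU : {z | z ≠ p → z ∉ lattice τ} ∈ 𝓝 p :=
      eventually_nhdsWithin_iff.mp (eventually_notMem_lattice hτ p)
    have hd : DifferentiableOn ℂ f ({z | z ≠ p → z ∉ lattice τ} \ {p}) := fun z hz =>
      (hf z (hz.1 hz.2)).differentiableWithinAt
    have hne : ∀ᶠ z in 𝓝[≠] p, z - p ≠ 0 := by
      filter_upwards [self_mem_nhdsWithin] with z hz
      simpa [sub_eq_zero] using hz
    have ho : (fun z => f z - f p) =o[𝓝[≠] p] fun z => (z - p)⁻¹ := by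
      rw [Asymptotics.isLittleO_iff_tendsto' (by
        filter_upwards [hne] with z hz h
        simp [hz] at h)]
      have hc : Tendsto (fun z => (z - p) * f p) (𝓝[≠] p) (𝓝 0) := by
        have : ContinuousAt (fun z => (z - p) * f p) p := by fun_prop
        simpa using this.tendsto.mono_left nhdsWithin_le_nhds
      have := (hlim p).sub hc
      rw [sub_zero] at this
      refine this.congr fun z => ?_
      rw [div_inv_eq_mul]; ring
    have := (differentiableOn_update_limUnder_of_isLittleO hU hd ho).differentiableAt hU
    refine this.congr_of_eventuallyEq ?_
    filter_upwards [hU] with z hz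
    by_cases hzp : z = p
    · subst hzp; simp [hg]
    · rw [Function.update_of_ne hzp, hgf z (hz hzp)]
  -- This ball contains a representative of every class modulo the lattice, so a bound on it is
  -- global.
  obtain ⟨M, hM⟩ := (isCompact_closedBall (0 : ℂ) (1 + ‖τ‖)).exists_bound_of_continuousOn
    hgd.continuous.continuousOn
  have hfM : ∀ z ∉ lattice τ, ‖g z‖ ≤ M := by
    intro z hz
    obtain ⟨s, hs, hzs⟩ := exists_lattice_norm_sub_le hτ z
    have hzs' : z - s ∉ lattice τ := fun h => hz (by simpa using (lattice τ).add_mem h hs)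
    rw [hgf z hz, ← sub_add_cancel z s, hper s hs, ← hgf _ hzs']
    exact hM _ (by simpa using hzs)
  have hgM : ∀ z, ‖g z‖ ≤ M := fun z =>
    le_of_tendsto ((hgd.continuous.norm.tendsto z).mono_left nhdsWithin_le_nhds)
      ((eventually_notMem_lattice hτ z).mono hfM)
  obtain ⟨C, hC⟩ := hgd.exists_const_forall_eq_of_bounded
    ((isBounded_iff_forall_norm_le).mpr ⟨M, by rintro _ ⟨z, rfl⟩; exact hgM z⟩)
  exact ⟨C, fun z hz => by rw [← hgf z hz, hC]⟩

/-! ### The exponential, and functions with multipliers -/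

theorem e_add (x y : ℂ) : e (x + y) = e x * e y := by
  unfold e; rw [mul_add, Complex.exp_add]

theorem e_ne_zero (x : ℂ) : e x ≠ 0 := Complex.exp_ne_zero _

theorem e_zero : e 0 = 1 := by simp [e]

theorem e_neg (x : ℂ) : e (-x) = (e x)⁻¹ := by
  unfold e; rw [mul_neg, Complex.exp_neg]

theorem e_int_mul (m : ℤ) (x : ℂ) : e (m * x) = e x ^ m := by
  unfold e; rw [← Complex.exp_int_mul]; congr 1; ring

theorem e_nat_mul (m : ℕ) (x : ℂ) : e (m * x) = e x ^ m := by
  simpa using e_int_mul m x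

theorem e_eq_one_iff {x : ℂ} : e x = 1 ↔ ∃ m : ℤ, x = m := by
  unfold e
  rw [Complex.exp_eq_one_iff]
  refine exists_congr fun m => ?_
  rw [mul_comm (m : ℂ)]
  exact mul_right_inj' two_pi_I_ne_zero

theorem e_int (m : ℤ) : e m = 1 := e_eq_one_iff.mpr ⟨m, rfl⟩

theorem e_one : e 1 = 1 := by simpa using e_int 1

theorem differentiable_e : Differentiable ℂ e := by
  unfold e; fun_prop

theorem norm_e (x : ℂ) : ‖e x‖ = Real.exp (-(2 * Real.pi * x.im)) := by
  rw [e, Complex.norm_exp]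
  congr 1
  simp

theorem e_eq_zpow_iff {τ x : ℂ} {m : ℤ} : e x = e τ ^ m ↔ ∃ k : ℤ, x = k + m * τ := by
  rw [← e_int_mul, ← div_eq_one_iff_eq (e_ne_zero _), div_eq_mul_inv, ← e_neg, ← e_add,
    e_eq_one_iff]
  exact exists_congr fun k => by rw [← sub_eq_add_neg, sub_eq_iff_eq_add]

theorem mem_lattice_iff_e {τ x : ℂ} : x ∈ lattice τ ↔ ∃ m : ℤ, e x = e τ ^ m := by
  simp_rw [e_eq_zpow_iff, mem_lattice]
  exact exists_comm

/-- A function with removable singularities on the torus and a multiplier which is not a power of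
`e τ` vanishes. -/
theorem eq_zero_of_multiplier {τ c : ℂ} (hτ : 0 < τ.im) (hc0 : c ≠ 0) (hc : ∀ m : ℤ, c ≠ e τ ^ m)
    {f : ℂ → ℂ} (hf : ∀ z ∉ lattice τ, DifferentiableAt ℂ f z)
    (h1 : ∀ z, f (z + 1) = f z) (h2 : ∀ z, f (z + τ) = c * f z)
    (h0 : Tendsto (fun z => z * f z) (𝓝[≠] 0) (𝓝 0)) :
    ∀ z ∉ lattice τ, f z = 0 := by
  -- Twisting by `e (r * z)` multiplies the factor for `τ` by `e (r * τ)`. This `r` makes the new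
  -- factor unimodular, and since `r` is real the factor `e r` for the period 1 is unimodular too.
  set r : ℝ := Real.log ‖c‖ / (2 * Real.pi * τ.im) with hr
  have hnorm : ‖c * e (r * τ)‖ = 1 := by
    rw [norm_mul, norm_e]
    have : 2 * Real.pi * ((r : ℂ) * τ).im = Real.log ‖c‖ := by
      rw [im_ofReal_mul, hr]
      field_simp
    rw [this, Real.exp_neg, Real.exp_log (norm_pos_iff.mpr hc0)]
    exact mul_inv_cancel₀ (norm_ne_zero_iff.mpr hc0)
  have hnorm1 : ‖e r‖ = 1 := by rw [norm_e]; simp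
  have k1 : ∀ z, f (z + 1) * e (r * (z + 1)) = e r * (f z * e (r * z)) := fun z => by
    rw [h1, mul_add, mul_one, e_add]; ring
  have k2 : ∀ z, f (z + τ) * e (r * (z + τ)) = (c * e (r * τ)) * (f z * e (r * z)) := fun z => by
    rw [h2, mul_add, e_add]; ring
  have hed : Differentiable ℂ fun z : ℂ => e (r * z) :=
    differentiable_e.comp (by fun_prop)
  obtain ⟨C, hC⟩ := exists_const_of_norm_periodic hτ (f := fun z => f z * e (r * z))
    (fun z hz => (hf z hz).mul (hed z))
    (fun z => by rw [k1, norm_mul, hnorm1, one_mul])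
    (fun z => by rw [k2, norm_mul, hnorm, one_mul])
    (by
      have := h0.mul ((hed.continuous.tendsto 0).mono_left nhdsWithin_le_nhds)
      rw [zero_mul] at this
      exact this.congr fun z => by ring)
  -- If the constant were nonzero, both factors would be 1. Then `r` is an integer `m` and `c = e τ
  -- ^ (-m)`, which is excluded.
  have hCz : C = 0 := by
    by_contra hC0
    obtain ⟨z, hz⟩ := (eventually_notMem_lattice hτ 0).exists
    have hz1 : z + 1 ∉ lattice τ := fun h =>
      hz (by simpa using (lattice τ).sub_mem h (one_mem_lattice τ))
    have hz2 : z + τ ∉ lattice τ := fun h =>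
      hz (by simpa using (lattice τ).sub_mem h (self_mem_lattice τ))
    have j1 := k1 z
    have j2 := k2 z
    rw [hC z hz, hC _ hz1] at j1
    rw [hC z hz, hC _ hz2] at j2
    obtain ⟨m, hm⟩ := e_eq_one_iff.mp (mul_right_cancel₀ hC0 ((one_mul C).trans j1)).symm
    have := (mul_right_cancel₀ hC0 ((one_mul C).trans j2)).symm
    rw [hm, e_int_mul] at this
    refine hc (-m) ?_
    rw [zpow_neg]
    exact eq_inv_of_mul_eq_one_left this
  intro z hz
  have := hC z hz
  rw [hCz] at this
  exact (mul_eq_zero.mp this).resolve_right (e_ne_zero _)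

/-! ### Theta: quasi-periodicity, oddness and nontriviality -/

theorem theta_eq_jacobiTheta₂ (τ υ : ℂ) :
    theta τ υ = -I * cexp (Real.pi * I * (τ / 4 + υ)) * jacobiTheta₂ (υ + τ / 2 + 1 / 2) τ := by
  rw [theta, jacobiTheta₂, one_div, inv_I, mul_assoc (-I), ← tsum_mul_left (a := cexp _)]
  congr 1
  refine tsum_congr fun n => ?_
  have h : (-1 : ℂ) ^ n = cexp (Real.pi * I * n) := by
    rw [← exp_pi_mul_I, ← Complex.exp_int_mul, mul_comm]
  rw [h, e, e, jacobiTheta₂_term, ← Complex.exp_add, ← Complex.exp_add, ← Complex.exp_add]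
  congr 1
  ring

variable {τ : ℂ}

theorem differentiable_theta (hτ : 0 < τ.im) : Differentiable ℂ (theta τ) := by
  have h : theta τ = fun υ =>
      -I * cexp (Real.pi * I * (τ / 4 + υ)) * jacobiTheta₂ (υ + τ / 2 + 1 / 2) τ :=
    funext (theta_eq_jacobiTheta₂ τ)
  rw [h]
  have hj : Differentiable ℂ fun z => jacobiTheta₂ z τ := fun z =>
    differentiableAt_jacobiTheta₂_fst z hτ
  have := hj.comp (f := fun υ : ℂ => υ + τ / 2 + 1 / 2) (by fun_prop)
  exact Differentiable.mul (by fun_prop) this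

theorem theta_add_self (τ υ : ℂ) : theta τ (υ + τ) = -e (-(τ / 2) - υ) * theta τ υ := by
  rw [theta_eq_jacobiTheta₂, theta_eq_jacobiTheta₂,
    show υ + τ + τ / 2 + 1 / 2 = (υ + τ / 2 + 1 / 2) + τ by ring, jacobiTheta₂_add_left']
  have h : cexp (Real.pi * I * (τ / 4 + (υ + τ))) *
      cexp (-Real.pi * I * (τ + 2 * (υ + τ / 2 + 1 / 2))) =
      -e (-(τ / 2) - υ) * cexp (Real.pi * I * (τ / 4 + υ)) := by
    rw [e, ← Complex.exp_add, neg_mul (cexp _), ← Complex.exp_add,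
      show Real.pi * I * (τ / 4 + (υ + τ)) + -Real.pi * I * (τ + 2 * (υ + τ / 2 + 1 / 2)) =
        (2 * Real.pi * I * (-(τ / 2) - υ) + Real.pi * I * (τ / 4 + υ)) + -(Real.pi * I) by ring,
      Complex.exp_add _ (-(Real.pi * I)), Complex.exp_neg, exp_pi_mul_I]
    norm_num
  linear_combination (-I * jacobiTheta₂ (υ + τ / 2 + 1 / 2) τ) * h

/-- Evenness of `jacobiTheta₂` gives this after a shift by `1 + τ`, because its argument is offset
by the half period `(1 + τ) / 2`. -/
theorem theta_neg (τ υ : ℂ) : theta τ (-υ) = -theta τ υ := by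
  rw [theta_eq_jacobiTheta₂, theta_eq_jacobiTheta₂,
    ← jacobiTheta₂_neg_left, show υ + τ / 2 + 1 / 2 = (-(-υ + τ / 2 + 1 / 2) + 1) + τ by ring,
    jacobiTheta₂_add_left', jacobiTheta₂_add_left]
  have h : cexp (Real.pi * I * (τ / 4 + -υ)) =
      -(cexp (Real.pi * I * (τ / 4 + υ)) *
        cexp (-Real.pi * I * (τ + 2 * (-(-υ + τ / 2 + 1 / 2) + 1)))) := by
    rw [← Complex.exp_add,
      show Real.pi * I * (τ / 4 + υ) + -Real.pi * I * (τ + 2 * (-(-υ + τ / 2 + 1 / 2) + 1)) =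
        Real.pi * I * (τ / 4 + -υ) + -(Real.pi * I) by ring,
      Complex.exp_add, Complex.exp_neg (Real.pi * I), exp_pi_mul_I]
    norm_num
  linear_combination (-I * jacobiTheta₂ (-(-υ + τ / 2 + 1 / 2)) τ) * h

theorem theta_zero (τ : ℂ) : theta τ 0 = 0 := by
  have h := theta_neg τ 0
  rw [neg_zero] at h
  exact self_eq_neg.mp h

theorem theta_eq_zero_of_mem_lattice {z : ℂ} (hz : z ∈ lattice τ) : theta τ z = 0 := by
  have := eq_of_periodic_of_mem_lattice (f := fun z => theta τ z = 0) (τ := τ)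
    (fun z => by simp [theta_add_one])
    (fun z => by simp [theta_add_self, e_ne_zero]) hz 0
  rw [zero_add] at this
  exact this.mpr (theta_zero τ)

/-- Integration over a period isolates the zeroth Fourier coefficient. It serves to show that theta
is not identically zero. -/
theorem integral_jacobiTheta₂ (hτ : 0 < τ.im) :
    ∫ x in (0 : ℝ)..1, jacobiTheta₂ x τ = 1 := by
  have hterm : ∀ n : ℤ, ∫ x in (0 : ℝ)..1, jacobiTheta₂_term n x τ = if n = 0 then 1 else 0 := by
    intro n
    split_ifs with hn
    · simp [hn, jacobiTheta₂_term]
    · have hc : 2 * Real.pi * I * n ≠ 0 := mul_ne_zero two_pi_I_ne_zero (by exact_mod_cast hn)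
      simp only [jacobiTheta₂_term, Complex.exp_add]
      rw [intervalIntegral.integral_mul_const, integral_exp_mul_complex hc]
      have : cexp (2 * Real.pi * I * n * (1 : ℝ)) = 1 := by
        rw [Complex.exp_eq_one_iff]
        exact ⟨n, by push_cast; ring⟩
      rw [this]; simp
  have hsum : HasSum (fun n : ℤ => ∫ x in (0 : ℝ)..1, jacobiTheta₂_term n x τ)
      (∫ x in (0 : ℝ)..1, ∑' n : ℤ, jacobiTheta₂_term n x τ) := by
    have hb := summable_pow_mul_jacobiTheta₂_term_bound 0 hτ 0
    refine intervalIntegral.hasSum_integral_of_dominated_convergence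
      (fun n _ => Real.exp (-Real.pi * (τ.im * n ^ 2 - 2 * 0 * |n|))) ?_ ?_ ?_ ?_ ?_
    · intro n
      have : Continuous fun x : ℝ => jacobiTheta₂_term n x τ := by
        unfold jacobiTheta₂_term; fun_prop
      exact this.aestronglyMeasurable
    · intro n
      filter_upwards with x _
      exact norm_jacobiTheta₂_term_le hτ (by simp) le_rfl n
    · filter_upwards with x _
      simpa using hb
    · exact intervalIntegrable_const
    · filter_upwards with x _
      exact hasSum_jacobiTheta₂_term _ hτ
  simp_rw [hterm] at hsum
  exact (hsum.unique (hasSum_ite_eq 0 1))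

theorem exists_theta_ne_zero (hτ : 0 < τ.im) : ∃ z, theta τ z ≠ 0 := by
  by_contra! h
  have hj : ∀ z, jacobiTheta₂ z τ = 0 := by
    intro z
    have := h (z - τ / 2 - 1 / 2)
    rw [theta_eq_jacobiTheta₂, show z - τ / 2 - 1 / 2 + τ / 2 + 1 / 2 = z by ring] at this
    simpa using this
  have := integral_jacobiTheta₂ hτ
  simp [hj] at this

/-! ### The triple product and the zeros of theta -/

/-- The infinite product `∏ (1 - q ^ m x)` over `m ≥ 0`. -/
noncomputable def qProd (q x : ℂ) : ℂ := ∏' m : ℕ, (1 + -(q ^ m * x))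

theorem summable_norm_pow_mul {q : ℂ} (hq : ‖q‖ < 1) (x : ℂ) :
    Summable fun m : ℕ => ‖-(q ^ m * x)‖ := by
  simp_rw [norm_neg, norm_mul, norm_pow]
  exact (summable_geometric_of_lt_one (norm_nonneg _) hq).mul_right _

theorem qProd_eq_mul {q : ℂ} (hq : ‖q‖ < 1) (x : ℂ) :
    qProd q x = (1 - x) * qProd q (q * x) := by
  have h : ∀ m : ℕ, 1 + -(q ^ (m + 1) * x) = 1 + -(q ^ m * (q * x)) := fun m => by ring
  rw [qProd, tprod_eq_zero_mul', qProd]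
  · simp_rw [h]; ring
  · simp_rw [h]
    exact multipliable_one_add_of_summable (summable_norm_pow_mul hq _)

theorem qProd_ne_zero {q x : ℂ} (hq : ‖q‖ < 1) (h : ∀ m : ℕ, q ^ m * x ≠ 1) : qProd q x ≠ 0 :=
  tprod_one_add_ne_zero_of_summable
    (fun m => by rw [← sub_eq_add_neg, sub_ne_zero]; exact (h m).symm) (summable_norm_pow_mul hq x)

theorem differentiable_qProd {q : ℂ} (hq : ‖q‖ < 1) : Differentiable ℂ (qProd q) := by
  intro x
  have hK : IsOpen (Metric.ball (0 : ℂ) (‖x‖ + 1)) := Metric.isOpen_ball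
  have h := Summable.hasProdLocallyUniformlyOn_nat_one_add (f := fun (m : ℕ) (x : ℂ) => -(q ^ m * x)) hK
    (u := fun m => ‖q‖ ^ m * (‖x‖ + 1))
    ((summable_geometric_of_lt_one (norm_nonneg _) hq).mul_right _)
    (.of_forall fun m y hy => by
      rw [norm_neg, norm_mul, norm_pow]
      have : ‖y‖ < ‖x‖ + 1 := by simpa using hy
      gcongr)
    (fun m => by fun_prop)
  refine (h.differentiableOn (.of_forall fun s => ?_) hK).differentiableAt
    (hK.mem_nhds (by simp))
  simpa [Finset.prod_fn] using DifferentiableOn.finsetProd (fun _ _ => by fun_prop)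

theorem norm_e_lt_one (hτ : 0 < τ.im) : ‖e τ‖ < 1 := by
  rw [norm_e, Real.exp_lt_one_iff, neg_neg_iff_pos]
  positivity

/-- The product side of the Jacobi triple product, up to a constant. -/
noncomputable def thetaProd (τ u : ℂ) : ℂ := qProd (e τ) (e u) * qProd (e τ) (e τ * e (-u))

theorem differentiable_thetaProd (hτ : 0 < τ.im) : Differentiable ℂ (thetaProd τ) := by
  have h := differentiable_qProd (norm_e_lt_one hτ)
  have he := differentiable_e
  have h1 := h.comp he
  have h2 := h.comp (f := fun u => e τ * e (-u))
    ((he.comp (f := fun u => -u) (by fun_prop)).const_mul _)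
  exact h1.mul h2

theorem thetaProd_add_one (τ u : ℂ) : thetaProd τ (u + 1) = thetaProd τ u := by
  rw [thetaProd, thetaProd, neg_add, e_add, e_add, e_neg 1, e_one, inv_one, mul_one, mul_one]

/-- The shift drops the factor `1 - e u` from one product and adds `1 - e (-u) = -e (-u) * (1 - e
u)` to the other. -/
theorem thetaProd_add_self (hτ : 0 < τ.im) (u : ℂ) :
    thetaProd τ (u + τ) = -e (-u) * thetaProd τ u := by
  have hq := norm_e_lt_one hτ
  have h1 : e τ * e (-(u + τ)) = e (-u) := by rw [← e_add]; congr 1; ring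
  have h2 : e u * e (-u) = 1 := by rw [← e_add, add_neg_cancel, e_zero]
  rw [thetaProd, thetaProd, h1, qProd_eq_mul hq (e u), qProd_eq_mul hq (e (-u)), add_comm u,
    e_add]
  linear_combination (-qProd (e τ) (e τ * e u) * qProd (e τ) (e τ * e (-u))) * h2

theorem thetaProd_ne_zero (hτ : 0 < τ.im) {u : ℂ} (hu : u ∉ lattice τ) : thetaProd τ u ≠ 0 := by
  have hq := norm_e_lt_one hτ
  refine mul_ne_zero (qProd_ne_zero hq fun m h => hu ?_) (qProd_ne_zero hq fun m h => hu ?_)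
  · exact mem_lattice_iff_e.mpr ⟨-m, by
      rw [zpow_neg, zpow_natCast]; exact eq_inv_of_mul_eq_one_right h⟩
  · refine mem_lattice_iff_e.mpr ⟨(m + 1 : ℕ), ?_⟩
    rw [zpow_natCast, pow_succ]
    rw [e_neg, ← mul_assoc] at h
    exact (eq_of_mul_inv_eq_one h).symm

theorem thetaProd_eq_mul (hτ : 0 < τ.im) (u : ℂ) : thetaProd τ u =
    (1 - e u) * (qProd (e τ) (e τ * e u) * qProd (e τ) (e τ * e (-u))) := by
  rw [thetaProd, qProd_eq_mul (norm_e_lt_one hτ) (e u), mul_assoc]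

theorem hasDerivAt_thetaProd_zero (hτ : 0 < τ.im) :
    HasDerivAt (thetaProd τ) (-(2 * Real.pi * I) * qProd (e τ) (e τ) ^ 2) 0 := by
  have hq := differentiable_qProd (norm_e_lt_one hτ)
  have he := differentiable_e
  have h1 : HasDerivAt e (2 * Real.pi * I) 0 := by
    have := ((hasDerivAt_id (0 : ℂ)).const_mul (2 * Real.pi * I)).cexp
    have he' : e = fun x => cexp (2 * Real.pi * I * x) := rfl
    rw [he']
    simpa using this
  have hd : Differentiable ℂ fun u =>
      qProd (e τ) (e τ * e u) * qProd (e τ) (e τ * e (-u)) :=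
    (hq.comp (f := fun u => e τ * e u) (he.const_mul _)).mul
      (hq.comp (f := fun u => e τ * e (-u)) ((he.comp (f := fun u => -u) (by fun_prop)).const_mul _))
  have := (h1.const_sub 1).mul (hd 0).hasDerivAt
  have hfun : thetaProd τ = (fun u => 1 - e u) * fun u =>
      qProd (e τ) (e τ * e u) * qProd (e τ) (e τ * e (-u)) := funext (thetaProd_eq_mul hτ)
  rw [neg_zero, e_zero, sub_self, zero_mul, add_zero, mul_one] at this
  rw [hfun, sq]
  exact this

theorem qProd_self_ne_zero (hτ : 0 < τ.im) : qProd (e τ) (e τ) ≠ 0 := by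
  have hq := norm_e_lt_one hτ
  refine qProd_ne_zero hq fun m h => ?_
  have := congrArg norm h
  rw [← pow_succ, norm_pow, norm_one] at this
  exact (pow_lt_one₀ (norm_nonneg _) hq m.succ_ne_zero).ne this

theorem tendsto_div_of_hasDerivAt {f : ℂ → ℂ} {f' : ℂ} (hf : HasDerivAt f f' 0) (h0 : f 0 = 0) :
    Tendsto (fun z => f z / z) (𝓝[≠] 0) (𝓝 f') := by
  have := hasDerivAt_iff_tendsto_slope.mp hf
  refine this.congr fun z => ?_
  rw [slope_def_field, h0, sub_zero, sub_zero]

/-- The **Jacobi triple product**, with an unspecified constant. -/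
theorem exists_theta_eq_mul_thetaProd (hτ : 0 < τ.im) :
    ∃ C ≠ 0, ∀ z, theta τ z = C * (e (-(z / 2)) * thetaProd τ z) := by
  have hT := differentiable_theta hτ
  have hP := differentiable_thetaProd hτ
  have hE : ∀ c : ℂ, Differentiable ℂ fun z => e (c * z) := fun c =>
    differentiable_e.comp (by fun_prop)
  have hE1 := hE (1 / 2)
  have hE2 := hE (-1 / 2)
  have hP0 : thetaProd τ 0 = 0 := by rw [thetaProd_eq_mul hτ, e_zero, sub_self, zero_mul]
  -- The factor `e (z / 2)` makes the multipliers of theta and of the product agree. At 0 the simple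
  -- zero of the denominator is matched by `theta_zero`.
  obtain ⟨C, hC⟩ := exists_const_of_norm_periodic hτ
    (f := fun z => theta τ z * e (1 / 2 * z) / thetaProd τ z)
    (fun z hz => ((hT z).mul (hE1 z)).div (hP z) (thetaProd_ne_zero hτ hz))
    (fun z => by
      rw [theta_add_one, thetaProd_add_one, mul_add, e_add, norm_div, norm_div, norm_mul,
        norm_mul, norm_mul, norm_neg, norm_e (1 / 2 * 1)]
      simp)
    (fun z => by
      congr 1
      have h : e (-(τ / 2) - z) * e (1 / 2 * (z + τ)) = e (1 / 2 * z) * e (-z) := by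
        rw [← e_add, ← e_add]; congr 1; ring
      rw [theta_add_self, thetaProd_add_self hτ, neg_mul, neg_mul, neg_mul, neg_div_neg_eq,
        mul_right_comm, h, mul_comm (e _ * _), mul_comm (e (1 / 2 * z)),
        mul_comm (theta τ z) (e (-z) * _), mul_assoc, mul_div_mul_left _ _ (e_ne_zero _),
        mul_comm (theta τ z)])
    (by
      have h1 := tendsto_div_of_hasDerivAt (hasDerivAt_thetaProd_zero hτ) hP0
      have h2 := (hT.mul hE1).continuous.tendsto 0
      have h3 := (h2.mono_left nhdsWithin_le_nhds).div h1 (mul_ne_zero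
        (neg_ne_zero.mpr two_pi_I_ne_zero) (pow_ne_zero 2 (qProd_self_ne_zero hτ)))
      simp only [Pi.mul_apply, theta_zero, zero_mul, zero_div] at h3
      refine h3.congr fun z => ?_
      simp only [Pi.div_apply, Pi.mul_apply]
      rw [div_div_eq_mul_div, mul_div_assoc', mul_comm z])
  have hoff : ∀ z ∉ lattice τ, theta τ z = C * (e (-1 / 2 * z) * thetaProd τ z) := by
    intro z hz
    have h := hC z hz
    rw [div_eq_iff (thetaProd_ne_zero hτ hz)] at h
    have hee : e (1 / 2 * z) * e (-1 / 2 * z) = 1 := by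
      rw [← e_add, ← e_zero]; congr 1; ring
    linear_combination e (-1 / 2 * z) * h - theta τ z * hee
  have hall : ∀ z, theta τ z = C * (e (-1 / 2 * z) * thetaProd τ z) := by
    intro z
    have hd : Continuous fun z => theta τ z - C * (e (-1 / 2 * z) * thetaProd τ z) :=
      (hT.sub ((hE2.mul hP).const_mul C)).continuous
    have h1 := (hd.tendsto z).mono_left (nhdsWithin_le_nhds (s := {z}ᶜ))
    refine sub_eq_zero.mp (tendsto_nhds_unique h1 (tendsto_const_nhds.congr' ?_))
    filter_upwards [eventually_notMem_lattice hτ z] with w hw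
    rw [hoff w hw, sub_self]
  refine ⟨C, ?_, fun z => by rw [hall]; congr 3; ring⟩
  rintro rfl
  obtain ⟨z, hz⟩ := exists_theta_ne_zero hτ
  exact hz (by rw [hall, zero_mul])

theorem theta_eq_zero_iff (hτ : 0 < τ.im) {z : ℂ} : theta τ z = 0 ↔ z ∈ lattice τ := by
  refine ⟨fun h => ?_, theta_eq_zero_of_mem_lattice⟩
  obtain ⟨C, hC, hall⟩ := exists_theta_eq_mul_thetaProd hτ
  by_contra hz
  rw [hall] at h
  exact mul_ne_zero hC (mul_ne_zero (e_ne_zero _) (thetaProd_ne_zero hτ hz)) h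

theorem deriv_theta_zero_ne_zero (hτ : 0 < τ.im) : deriv (theta τ) 0 ≠ 0 := by
  obtain ⟨C, hC, hall⟩ := exists_theta_eq_mul_thetaProd hτ
  have hP0 : thetaProd τ 0 = 0 := by rw [thetaProd_eq_mul hτ, e_zero, sub_self, zero_mul]
  have hE : Differentiable ℂ fun z => e (-(z / 2)) := differentiable_e.comp (by fun_prop)
  have h := (((hE 0).hasDerivAt.mul (hasDerivAt_thetaProd_zero hτ)).const_mul C).deriv
  have hfun : theta τ = fun z => C * ((fun z => e (-(z / 2))) * thetaProd τ) z := funext hall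
  rw [hfun, h, hP0, mul_zero, zero_add]
  exact mul_ne_zero hC (mul_ne_zero (e_ne_zero _) (mul_ne_zero
    (neg_ne_zero.mpr two_pi_I_ne_zero) (pow_ne_zero 2 (qProd_self_ne_zero hτ))))

/-! ### The Kronecker function: multipliers, oddness and residue -/

theorem Del_add_self_left (τ a b : ℂ) : Del τ (a + τ) b = e (-b) * Del τ a b := by
  have h : e (-(τ / 2) - (a + b)) = e (-(τ / 2) - a) * e (-b) := by
    rw [← e_add]; congr 1; ring
  unfold Del
  rw [add_right_comm, theta_add_self, theta_add_self, h]
  have h0 := e_ne_zero (-(τ / 2) - a)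
  rw [show deriv (theta τ) 0 * (-(e (-(τ / 2) - a) * e (-b)) * theta τ (a + b)) =
      -e (-(τ / 2) - a) * (e (-b) * (deriv (theta τ) 0 * theta τ (a + b))) by ring,
    mul_assoc (-e _), mul_div_mul_left _ _ (neg_ne_zero.mpr h0), mul_div_assoc]

theorem Del_add_int_mul_left (τ a b : ℂ) (k : ℤ) :
    Del τ (a + k * τ) b = e (-(k * b)) * Del τ a b := by
  induction k with
  | zero => simp [e_zero]
  | succ i ih =>
    have := Del_add_self_left τ (a + (i : ℤ) * τ) b
    rw [ih, ← mul_assoc, ← e_add] at this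
    convert this using 2
    · push_cast; ring
    · congr 1; push_cast; ring
  | pred i ih =>
    have := Del_add_self_left τ (a + (-i - 1 : ℤ) * τ) b
    rw [show a + (-i - 1 : ℤ) * τ + τ = a + (-i : ℤ) * τ by push_cast; ring, ih] at this
    have h2 : e b * e (-b) = 1 := by rw [← e_add, add_neg_cancel, e_zero]
    have h3 : e (-((-i - 1 : ℤ) * b)) = e b * e (-((-i : ℤ) * b)) := by
      rw [← e_add]; congr 1; push_cast; ring
    linear_combination (-e b) * this - Del τ (a + (-i - 1 : ℤ) * τ) b * h2 - Del τ a b * h3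

theorem Del_add_lattice_left (τ a b : ℂ) (k l : ℤ) :
    Del τ (a + (k + l * τ)) b = e (-(l * b)) * Del τ a b := by
  rw [← Del_add_int_mul_left, ← Del_add_int_left τ (a + l * τ) b k]
  congr 1; ring

theorem Del_neg (τ a b : ℂ) : Del τ (-a) (-b) = -Del τ a b := by
  unfold Del
  rw [← neg_add, theta_neg, theta_neg, theta_neg]
  ring

theorem differentiableAt_Del (hτ : 0 < τ.im) {a b : ℂ} (ha : a ∉ lattice τ) (hb : b ∉ lattice τ) :
    DifferentiableAt ℂ (fun z => Del τ z b) a := by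
  have hT := differentiable_theta hτ
  have h0 : theta τ a * theta τ b ≠ 0 :=
    mul_ne_zero (mt (theta_eq_zero_iff hτ).mp ha) (mt (theta_eq_zero_iff hτ).mp hb)
  have h1 : DifferentiableAt ℂ (fun z => theta τ (z + b)) a :=
    (hT (a + b)).comp a (f := fun z => z + b) (by fun_prop)
  exact (h1.const_mul _).div ((hT a).mul_const _) h0

theorem tendsto_mul_Del (hτ : 0 < τ.im) {b : ℂ} (hb : b ∉ lattice τ) :
    Tendsto (fun z => z * Del τ z b) (𝓝[≠] 0) (𝓝 1) := by
  have hT := differentiable_theta hτ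
  have hb0 : theta τ b ≠ 0 := mt (theta_eq_zero_iff hτ).mp hb
  have hd := deriv_theta_zero_ne_zero hτ
  have h1 := (tendsto_div_of_hasDerivAt (hT 0).hasDerivAt (theta_zero τ)).mul_const (theta τ b)
  have hc : Continuous fun z => deriv (theta τ) 0 * theta τ (z + b) :=
    (hT.continuous.comp (continuous_id.add continuous_const)).const_mul _
  have h2 := ((hc.tendsto 0).mono_left (nhdsWithin_le_nhds (s := {0}ᶜ))).div h1
    (mul_ne_zero hd hb0)
  rw [zero_add, div_self (mul_ne_zero hd hb0)] at h2
  refine h2.congr fun z => ?_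
  simp only [Pi.div_apply, Del]
  rw [div_mul_eq_mul_div, div_div_eq_mul_div, mul_div_assoc', mul_comm z]

/-! ### Expansion over the torsion points -/

theorem sum_range_add_one_of_periodic {f : ℤ → ℂ} {n : ℕ} (h : f n = f 0) :
    ∑ k ∈ Finset.range n, f (k + 1) = ∑ k ∈ Finset.range n, f k := by
  have h1 := Finset.sum_range_succ (fun k : ℕ => f k) n
  have h2 := Finset.sum_range_succ' (fun k : ℕ => f k) n
  push_cast at h2
  rw [h1, h] at h2
  exact (add_right_cancel h2).symm

theorem mem_lattice_of_natCast_mul {z : ℂ} (n : ℕ) (hz : z ∈ lattice τ) :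
    (n : ℂ) * z ∈ lattice τ := by
  rw [← nsmul_eq_mul]; exact (lattice τ).nsmul_mem hz n

theorem add_torsion_notMem_lattice {n : ℕ} (hn : 0 < n) {w : ℂ} (hw : w ∉ lattice τ) (k l : ℤ) :
    (w + k - l * τ) / n ∉ lattice τ := by
  intro h
  have hn0 : (n : ℂ) ≠ 0 := by exact_mod_cast hn.ne'
  have := mem_lattice_of_natCast_mul n h
  rw [mul_div_cancel₀ _ hn0] at this
  refine hw ?_
  have hkl : (k - l * τ : ℂ) ∈ lattice τ := ⟨k, -l, by push_cast; ring⟩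
  simpa [add_sub_assoc] using (lattice τ).sub_mem this hkl

theorem torsion_notMem_lattice (hτ : 0 < τ.im) {n k l : ℕ} (hk : k < n) (hl : l < n)
    (h0 : ¬(k = 0 ∧ l = 0)) : ((k : ℂ) - l * τ) / n ∉ lattice τ := by
  rintro ⟨m, j, h⟩
  have hn0 : (n : ℂ) ≠ 0 := by exact_mod_cast (Nat.zero_lt_of_lt hk).ne'
  rw [div_eq_iff hn0] at h
  have him := congrArg Complex.im h
  have h' : (m + j * τ) * n = ((m * n : ℤ) : ℂ) + ((j * n : ℤ) : ℂ) * τ := by push_cast; ring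
  rw [h'] at h him
  have hl' : -(l : ℤ) = j * n := by
    have : -(l : ℝ) * τ.im = ((j * n : ℤ) : ℝ) * τ.im := by
      simpa using him
    exact_mod_cast mul_right_cancel₀ hτ.ne' this
  have hk' : (k : ℤ) = m * n := by
    rw [← hl'] at h
    have : (k : ℂ) = ((m * n : ℤ) : ℂ) := by
      push_cast at h ⊢
      linear_combination h
    exact_mod_cast this
  refine h0 ⟨?_, ?_⟩
  · refine Nat.eq_zero_of_dvd_of_lt (a := n) ?_ hk
    exact Int.natCast_dvd_natCast.mp ⟨m, by rw [hk', mul_comm]⟩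
  · refine Nat.eq_zero_of_dvd_of_lt (a := n) ?_ hl
    exact Int.natCast_dvd_natCast.mp ⟨-j, by linarith⟩

/-- The summand of the expansion of `Del` over the `n`-torsion points. -/
noncomputable def torsionTerm (τ : ℂ) (n : ℕ) (a w : ℂ) (k l : ℤ) : ℂ :=
  e (-(l * a)) * Del τ ((w + k - l * τ) / n) (n * a)

theorem torsionTerm_add_one (n : ℕ) (a w : ℂ) (k l : ℤ) :
    torsionTerm τ n a (w + 1) k l = torsionTerm τ n a w (k + 1) l := by
  unfold torsionTerm
  push_cast
  congr 3
  ring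

theorem torsionTerm_add_self (n : ℕ) (a w : ℂ) (k l : ℤ) :
    torsionTerm τ n a (w + τ) k (l + 1) = e (-a) * torsionTerm τ n a w k l := by
  unfold torsionTerm
  rw [← mul_assoc, ← e_add]
  push_cast
  congr 2
  · ring
  · ring

theorem torsionTerm_natCast_left {n : ℕ} (hn : 0 < n) (a w : ℂ) (l : ℤ) :
    torsionTerm τ n a w n l = torsionTerm τ n a w (0 : ℤ) l := by
  have hn0 : (n : ℂ) ≠ 0 := by exact_mod_cast hn.ne'
  unfold torsionTerm
  rw [← Del_add_one_left τ ((w + (0 : ℤ) - l * τ) / n)]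
  congr 2
  push_cast
  field_simp
  ring

/-- The prefactor `e (-(n * a))` gained at `l = n` is exactly the multiplier of `Del` with second
argument `n * a` under a shift by `τ`. Hence the terms depend on `l` only modulo `n`. -/
theorem torsionTerm_natCast_right {n : ℕ} (hn : 0 < n) (a w : ℂ) (k : ℤ) :
    torsionTerm τ n a w k n = torsionTerm τ n a w k (0 : ℤ) := by
  have hn0 : (n : ℂ) ≠ 0 := by exact_mod_cast hn.ne'
  unfold torsionTerm
  rw [show (w + k - (0 : ℤ) * τ) / n = (w + k - ((n : ℤ) : ℂ) * τ) / n + τ by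
    push_cast; field_simp; ring, Del_add_self_left, ← mul_assoc, ← e_add]
  congr 2
  push_cast
  ring

/-- Expansion of the Kronecker function over the `n`-torsion points of the torus. -/
theorem Del_eq_sum_torsionTerm (hτ : 0 < τ.im) {n : ℕ} (hn : 0 < n) {a w : ℂ}
    (ha : n * a ∉ lattice τ) (hw : w ∉ lattice τ) :
    Del τ a w = 1 / n * ∑ k ∈ Finset.range n, ∑ l ∈ Finset.range n, torsionTerm τ n a w k l := by
  have hn0 : (n : ℂ) ≠ 0 := by exact_mod_cast hn.ne'
  have ha' : a ∉ lattice τ := fun h => ha (mem_lattice_of_natCast_mul n h)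
  have hterm : ∀ k l : ℤ, ∀ z, (z + k - l * τ) / n ∉ lattice τ →
      DifferentiableAt ℂ (fun z => torsionTerm τ n a z k l) z := fun k l z hz =>
    ((differentiableAt_Del hτ hz ha).comp z (f := fun z : ℂ => (z + k - l * τ) / n)
      (by fun_prop)).const_mul _
  -- Only the term `k = l = 0` has a pole at 0. Its residue is `n` because the argument is `z / n`,
  -- which the prefactor `1 / n` normalises.
  have hlim : ∀ k ∈ Finset.range n, ∀ l ∈ Finset.range n,
      Tendsto (fun z => z * torsionTerm τ n a z k l) (𝓝[≠] 0)
        (𝓝 (if k = 0 then (if l = 0 then (n : ℂ) else 0) else 0)) := by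
    intro k hk l hl
    rw [Finset.mem_range] at hk hl
    rw [← ite_and]
    split_ifs with h
    · obtain ⟨rfl, rfl⟩ := h
      have hdiv : Tendsto (fun z : ℂ => z / n) (𝓝[≠] 0) (𝓝[≠] 0) := by
        refine tendsto_nhdsWithin_iff.mpr ⟨?_, ?_⟩
        · have : ContinuousAt (fun z : ℂ => z / n) 0 := by fun_prop
          simpa using this.tendsto.mono_left (nhdsWithin_le_nhds (s := {0}ᶜ))
        · filter_upwards [self_mem_nhdsWithin] with z hz
          exact div_ne_zero hz hn0
      have := ((tendsto_mul_Del hτ ha).comp hdiv).const_mul (n : ℂ)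
      rw [mul_one] at this
      refine this.congr fun z => ?_
      simp only [Function.comp_apply, torsionTerm, Nat.cast_zero, Int.cast_zero, zero_mul,
        neg_zero, e_zero, one_mul, add_zero, sub_zero]
      rw [← mul_assoc, mul_div_cancel₀ _ hn0]
    · have hd := hterm k l 0 (by
        rw [zero_add]
        exact_mod_cast torsion_notMem_lattice hτ hk hl h)
      have : ContinuousAt (fun z => z * torsionTerm τ n a z k l) 0 :=
        continuousAt_id.mul hd.continuousAt
      simpa using this.tendsto.mono_left (nhdsWithin_le_nhds (s := {0}ᶜ))
  have key := eq_zero_of_multiplier hτ (e_ne_zero (-a))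
    (fun m h => ha' (by
      have := (lattice τ).neg_mem (mem_lattice_iff_e.mpr ⟨m, h⟩)
      rwa [neg_neg] at this))
    (f := fun z => Del τ a z -
      1 / n * ∑ k ∈ Finset.range n, ∑ l ∈ Finset.range n, torsionTerm τ n a z k l)
    (fun z hz => by
      refine DifferentiableAt.sub ?_ (DifferentiableAt.const_mul ?_ _)
      · rw [show Del τ a = fun z => Del τ z a from funext (Del_symm τ a)]
        exact differentiableAt_Del hτ hz ha'
      · exact DifferentiableAt.fun_sum fun k _ => DifferentiableAt.fun_sum fun l _ =>
          hterm k l z (add_torsion_notMem_lattice hn hz k l))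
    (fun z => by
      simp only [torsionTerm_add_one]
      rw [Del_symm, Del_add_one_left, Del_symm,
        sum_range_add_one_of_periodic (f := fun k => ∑ l ∈ Finset.range n, torsionTerm τ n a z k l)
          (Finset.sum_congr rfl fun l _ => torsionTerm_natCast_left hn a z l)])
    (fun z => by
      have h : ∀ k : ℕ, ∑ l ∈ Finset.range n, torsionTerm τ n a (z + τ) k l =
          e (-a) * ∑ l ∈ Finset.range n, torsionTerm τ n a z k l := by
        intro k
        rw [← sum_range_add_one_of_periodic (f := fun l => torsionTerm τ n a (z + τ) k l)
          (torsionTerm_natCast_right hn a _ k), Finset.mul_sum]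
        exact Finset.sum_congr rfl fun l _ => torsionTerm_add_self n a z k l
      rw [Finset.sum_congr rfl fun k _ => h k, ← Finset.mul_sum, Del_symm, Del_add_self_left,
        Del_symm]
      ring)
    (by
      have h1 := tendsto_mul_Del hτ ha'
      have h2 := (tendsto_finsetSum _ fun k hk =>
        tendsto_finsetSum _ fun l hl => hlim k hk l hl).const_mul (1 / n : ℂ)
      have h3 := h1.sub h2
      simp only [Finset.sum_ite_irrel, Finset.sum_const_zero, Finset.sum_ite_eq', Finset.mem_range,
        hn, if_true] at h3
      rw [one_div_mul_cancel hn0, sub_self] at h3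
      refine h3.congr fun z => ?_
      rw [mul_sub, Del_symm τ a, mul_left_comm z, Finset.mul_sum]
      simp_rw [← Finset.mul_sum])
  exact sub_eq_zero.mp (key w hw)

/-- Expansion of the Kronecker function at a translate by an `n`-torsion point. -/
theorem Del_torsion_eq_sum (hτ : 0 < τ.im) {n : ℕ} (hn : 0 < n) {a b : ℂ}
    (ha : n * a ∉ lattice τ) (hb : n * b ∉ lattice τ) (k l : ℤ) :
    Del τ ((k - l * τ) / n + a) (n * b) = 1 / n * ∑ k' ∈ Finset.range n, ∑ l' ∈ Finset.range n,
      e ((k' * l - k * l') / n) * e (l * b) * e (-(l' * a)) *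
        Del τ ((k' - l' * τ) / n + b) (n * a) := by
  have hn0 : (n : ℂ) ≠ 0 := by exact_mod_cast hn.ne'
  -- The torsion shift becomes a lattice shift of the second argument. Its multiplier and the
  -- prefactor `e (-(l' * _))` combine into the character; the terms in `l * l' * τ / n` cancel.
  have hx : n * ((k - l * τ) / n + a) = n * a + (k + (-l : ℤ) * τ) := by
    push_cast
    field_simp
    ring
  have ha' : n * ((k - l * τ) / n + a) ∉ lattice τ := by
    rw [hx]
    exact fun h => ha (by simpa using (lattice τ).sub_mem h ⟨k, -l, rfl⟩)
  rw [Del_eq_sum_torsionTerm hτ hn ha' hb]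
  congr 1
  refine Finset.sum_congr rfl fun k' _ => Finset.sum_congr rfl fun l' _ => ?_
  rw [torsionTerm, hx, Del_symm, Del_add_lattice_left, Del_symm, ← mul_assoc]
  have harg : ((n * b + (k' : ℤ) - (l' : ℤ) * τ) / n : ℂ) = (k' - l' * τ) / n + b := by
    push_cast
    field_simp
    ring
  rw [harg, ← e_add, ← e_add, ← e_add]
  congr 2
  push_cast
  field_simp
  ring

/-! ### Fourier analysis on `(ℤ/n)²` and the duality -/

theorem sum_e_mul_sub_div {n p r : ℕ} (hp : p < n) (hr : r < n) :
    ∑ k ∈ Finset.range n, e (k * ((p : ℂ) - r) / n) = if p = r then (n : ℂ) else 0 := by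
  have hn0 : (n : ℂ) ≠ 0 := by exact_mod_cast (Nat.zero_lt_of_lt hp).ne'
  have h : ∀ k : ℕ, e (k * ((p : ℂ) - r) / n) = e (((p : ℂ) - r) / n) ^ k := fun k => by
    rw [← e_nat_mul, mul_div_assoc]
  simp_rw [h]
  split_ifs with hpr
  · simp [hpr, e_zero]
  · have h1 : e (((p : ℂ) - r) / n) ≠ 1 := by
      rw [Ne, e_eq_one_iff]
      rintro ⟨m, hm⟩
      rw [div_eq_iff hn0] at hm
      have hm' : (p : ℤ) - r = m * n := by exact_mod_cast hm
      have hd : (n : ℤ) ∣ (p : ℤ) - r := ⟨m, by rw [hm', mul_comm]⟩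
      have := Int.eq_zero_of_abs_lt_dvd hd (by rw [abs_lt]; omega)
      omega
    rw [geom_sum_eq h1, ← e_nat_mul, mul_div_cancel₀ _ hn0]
    have : e ((p : ℂ) - r) = 1 := by
      have := e_int ((p : ℤ) - r)
      push_cast at this
      exact this
    rw [this, sub_self, zero_div]

/-- Parseval's identity on `(ℤ / n)²` for the symplectic Fourier transform. -/
theorem symplectic_parseval {n : ℕ} (A B : ℕ → ℕ → ℂ) :
    ∑ k ∈ Finset.range n, ∑ l ∈ Finset.range n,
      (∑ p ∈ Finset.range n, ∑ q ∈ Finset.range n, e (((p : ℂ) * l - k * q) / n) * A p q) *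
      (∑ r ∈ Finset.range n, ∑ s ∈ Finset.range n, e (((r : ℂ) * (-l) - (-k) * s) / n) * B r s) =
    n ^ 2 * ∑ p ∈ Finset.range n, ∑ q ∈ Finset.range n, A p q * B p q := by
  simp_rw [← Finset.sum_product', Finset.sum_mul_sum]
  rw [Finset.sum_comm, Finset.mul_sum]
  refine Finset.sum_congr rfl fun x hx => ?_
  rw [Finset.sum_comm]
  simp only [Finset.mem_product, Finset.mem_range] at hx
  have h : ∀ y ∈ Finset.range n ×ˢ Finset.range n, ∑ z ∈ Finset.range n ×ˢ Finset.range n,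
      e (((x.1 : ℂ) * z.2 - z.1 * x.2) / n) * A x.1 x.2 *
        (e (((y.1 : ℂ) * (-z.2) - (-z.1) * y.2) / n) * B y.1 y.2) =
      if y = x then n ^ 2 * (A x.1 x.2 * B x.1 x.2) else 0 := by
    intro y hy
    simp only [Finset.mem_product, Finset.mem_range] at hy
    -- The second transform is taken at `-z`, so its character is conjugated. The product of
    -- characters separates in the coordinates of `z`, and orthogonality applies to each.
    have hz : ∀ z : ℕ × ℕ, e (((x.1 : ℂ) * z.2 - z.1 * x.2) / n) * A x.1 x.2 *
        (e (((y.1 : ℂ) * (-z.2) - (-z.1) * y.2) / n) * B y.1 y.2) =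
        A x.1 x.2 * B y.1 y.2 *
          (e (z.1 * ((y.2 : ℂ) - x.2) / n) * e (z.2 * ((x.1 : ℂ) - y.1) / n)) := by
      intro z
      have : e (((x.1 : ℂ) * z.2 - z.1 * x.2) / n) * e (((y.1 : ℂ) * (-z.2) - (-z.1) * y.2) / n) =
          e (z.1 * ((y.2 : ℂ) - x.2) / n) * e (z.2 * ((x.1 : ℂ) - y.1) / n) := by
        rw [← e_add, ← e_add]; congr 1; ring
      linear_combination (A x.1 x.2 * B y.1 y.2) * this
    simp_rw [hz]
    rw [← Finset.mul_sum, Finset.sum_product]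
    dsimp only
    rw [← Finset.sum_mul_sum, sum_e_mul_sub_div hy.2 hx.2,
      sum_e_mul_sub_div hx.1 hy.1]
    by_cases hxy : y = x
    · subst hxy; simp; ring
    · rw [if_neg hxy]
      have : y.2 ≠ x.2 ∨ x.1 ≠ y.1 := by
        by_contra! hcon
        exact hxy (Prod.ext hcon.2.symm hcon.1)
      rcases this with h | h <;> simp [h]
  rw [Finset.sum_congr rfl h, Finset.sum_ite_eq', if_pos (by simpa using hx)]

/-- The duality of torsion sums, in additive notation. -/
theorem sum_Del_mul_Del (hτ : 0 < τ.im) {n : ℕ} (hn : 0 < n) {a₁ a₂ b₁ b₂ : ℂ}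
    (ha₁ : n * a₁ ∉ lattice τ) (ha₂ : n * a₂ ∉ lattice τ)
    (hb₁ : n * b₁ ∉ lattice τ) (hb₂ : n * b₂ ∉ lattice τ) :
    ∑ k ∈ Finset.range n, ∑ l ∈ Finset.range n, e (l * (b₂ - b₁)) *
        Del τ ((k - l * τ) / n + a₁) (n * b₁) * Del τ ((τ * l - k) / n + a₂) (n * b₂) =
      -∑ k ∈ Finset.range n, ∑ l ∈ Finset.range n, e (-(l * (a₁ + a₂))) *
        Del τ ((k - l * τ) / n + b₁) (n * a₁) * Del τ ((τ * l - k) / n + -b₂) (-(n * a₂)) := by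
  have hn0 : (n : ℂ) ≠ 0 := by exact_mod_cast hn.ne'
  have hP := symplectic_parseval (n := n)
    (fun p q => e (-(q * a₁)) * Del τ ((p - q * τ) / n + b₁) (n * a₁))
    (fun r s => e (-(s * a₂)) * Del τ ((r - s * τ) / n + b₂) (n * a₂))
  have h1 : ∀ k l : ℕ, Del τ ((k - l * τ) / n + a₁) (n * b₁) = e (l * b₁) * (1 / n *
      ∑ p ∈ Finset.range n, ∑ q ∈ Finset.range n, e (((p : ℂ) * l - k * q) / n) *
        (e (-(q * a₁)) * Del τ ((p - q * τ) / n + b₁) (n * a₁))) := by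
    intro k l
    have := Del_torsion_eq_sum hτ hn ha₁ hb₁ k l
    simp only [Int.cast_natCast] at this
    rw [this, mul_left_comm, Finset.mul_sum]
    simp_rw [Finset.mul_sum]
    refine Finset.sum_congr rfl fun p _ => Finset.sum_congr rfl fun q _ => ?_
    ring
  have h2 : ∀ k l : ℕ, Del τ ((τ * l - k) / n + a₂) (n * b₂) = e (-(l * b₂)) * (1 / n *
      ∑ p ∈ Finset.range n, ∑ q ∈ Finset.range n, e (((p : ℂ) * (-l) - (-k) * q) / n) *
        (e (-(q * a₂)) * Del τ ((p - q * τ) / n + b₂) (n * a₂))) := by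
    intro k l
    have := Del_torsion_eq_sum hτ hn ha₂ hb₂ (-k) (-l)
    simp only [Int.cast_natCast, Int.cast_neg] at this
    rw [show (τ * l - k : ℂ) = -k - -l * τ by ring, this, mul_left_comm, Finset.mul_sum]
    simp_rw [Finset.mul_sum]
    refine Finset.sum_congr rfl fun p _ => Finset.sum_congr rfl fun q _ => ?_
    rw [neg_mul (l : ℂ) b₂]
    ring
  have hL : ∀ k l : ℕ, e (l * (b₂ - b₁)) *
      Del τ ((k - l * τ) / n + a₁) (n * b₁) * Del τ ((τ * l - k) / n + a₂) (n * b₂) =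
      1 / n ^ 2 * ((∑ p ∈ Finset.range n, ∑ q ∈ Finset.range n, e (((p : ℂ) * l - k * q) / n) *
        (e (-(q * a₁)) * Del τ ((p - q * τ) / n + b₁) (n * a₁))) *
      ∑ p ∈ Finset.range n, ∑ q ∈ Finset.range n, e (((p : ℂ) * (-l) - (-k) * q) / n) *
        (e (-(q * a₂)) * Del τ ((p - q * τ) / n + b₂) (n * a₂))) := by
    intro k l
    rw [h1, h2]
    -- The weight on the left removes the exponentials in `b₁` and `b₂`, leaving a pure product of
    -- transforms.
    have he : e (l * (b₂ - b₁)) * e (l * b₁) * e (-(l * b₂)) = 1 := by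
      rw [← e_add, ← e_add, ← e_zero]; congr 1; ring
    generalize (∑ p ∈ Finset.range n, ∑ q ∈ Finset.range n, e (((p : ℂ) * l - k * q) / n) *
        (e (-(q * a₁)) * Del τ ((p - q * τ) / n + b₁) (n * a₁))) = X
    generalize (∑ p ∈ Finset.range n, ∑ q ∈ Finset.range n, e (((p : ℂ) * (-l) - (-k) * q) / n) *
        (e (-(q * a₂)) * Del τ ((p - q * τ) / n + b₂) (n * a₂))) = Y
    linear_combination (1 / n ^ 2 * (X * Y)) * he
  simp_rw [hL, ← Finset.mul_sum]
  rw [hP, ← mul_assoc, one_div_mul_cancel (pow_ne_zero 2 hn0), one_mul, ← Finset.sum_neg_distrib]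
  refine Finset.sum_congr rfl fun k _ => ?_
  rw [← Finset.sum_neg_distrib]
  refine Finset.sum_congr rfl fun l _ => ?_
  rw [show ((τ * l - k) / n + -b₂ : ℂ) = -((k - l * τ) / n + b₂) by ring, Del_neg,
    show -(l * (a₁ + a₂)) = -(l * a₁) + -(l * a₂) by ring, e_add]
  ring

/-! ### Passage to multiplicative notation -/

theorem exists_e_eq {x : ℂ} (hx : x ≠ 0) : ∃ a, e a = x :=
  ⟨log x / (2 * Real.pi * I), by
    rw [e, mul_div_cancel₀ _ two_pi_I_ne_zero, exp_log hx]⟩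

theorem natCast_mul_notMem_lattice {n : ℕ} {a : ℂ} (h : ∀ m : ℤ, e a ^ n ≠ e τ ^ m) :
    n * a ∉ lattice τ := by
  rw [mem_lattice_iff_e, e_nat_mul]
  rintro ⟨m, hm⟩
  exact h m hm

end EllTheta

theorem mainTheorem4 (n : ℕ) (hn : 0 < n) (τ : ℂ) (hτ : 0 < τ.im)
    (t₁ t₂ μ₁ μ₂ : ℂ) (ht₁ : t₁ ≠ 0) (ht₂ : t₂ ≠ 0) (hμ₁ : μ₁ ≠ 0) (hμ₂ : μ₂ ≠ 0)
    -- the point lies on no pole: none of the n-th powers is an integral power of q = e(τ)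
    (pt₁ : ∀ m : ℤ, t₁ ^ n ≠ EllTheta.e τ ^ m) (pt₂ : ∀ m : ℤ, t₂ ^ n ≠ EllTheta.e τ ^ m)
    (pμ₁ : ∀ m : ℤ, μ₁ ^ n ≠ EllTheta.e τ ^ m) (pμ₂ : ∀ m : ℤ, μ₂ ^ n ≠ EllTheta.e τ ^ m) :
    ∑ k ∈ Finset.range n, ∑ l ∈ Finset.range n,
        (μ₂ / μ₁) ^ l
          * EllTheta.delta τ (EllTheta.e (((k : ℂ) - (l : ℂ) * τ) / (n : ℂ)) * t₁) (μ₁ ^ n)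
          * EllTheta.delta τ (EllTheta.e ((τ * (l : ℂ) - (k : ℂ)) / (n : ℂ)) * t₂) (μ₂ ^ n)
      = -∑ k ∈ Finset.range n, ∑ l ∈ Finset.range n,
        (t₁ * t₂) ^ (-(l : ℤ))
          * EllTheta.delta τ (EllTheta.e (((k : ℂ) - (l : ℂ) * τ) / (n : ℂ)) * μ₁) (t₁ ^ n)
          * EllTheta.delta τ (EllTheta.e ((τ * (l : ℂ) - (k : ℂ)) / (n : ℂ)) * μ₂⁻¹)
              (t₂ ^ (-(n : ℤ))) := by
  obtain ⟨a₁, rfl⟩ := EllTheta.exists_e_eq ht₁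
  obtain ⟨a₂, rfl⟩ := EllTheta.exists_e_eq ht₂
  obtain ⟨b₁, rfl⟩ := EllTheta.exists_e_eq hμ₁
  obtain ⟨b₂, rfl⟩ := EllTheta.exists_e_eq hμ₂
  -- Each of the two factors `delta` in a summand contributes one `1 / (2πi)`.
  have key := congrArg ((1 / (2 * Real.pi * Complex.I)) ^ 2 * ·)
    (EllTheta.sum_Del_mul_Del hτ hn (EllTheta.natCast_mul_notMem_lattice pt₁)
      (EllTheta.natCast_mul_notMem_lattice pt₂) (EllTheta.natCast_mul_notMem_lattice pμ₁)
      (EllTheta.natCast_mul_notMem_lattice pμ₂))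
  simp only [mul_neg, Finset.mul_sum] at key
  have hpow : ∀ l : ℕ, (EllTheta.e b₂ / EllTheta.e b₁) ^ l = EllTheta.e (l * (b₂ - b₁)) := by
    intro l
    rw [div_eq_mul_inv, ← EllTheta.e_neg, ← EllTheta.e_add, ← EllTheta.e_nat_mul, sub_eq_add_neg]
  have hzpow : ∀ l : ℕ, EllTheta.e (a₁ + a₂) ^ (-(l : ℤ)) =
      EllTheta.e (-(l * (a₁ + a₂))) := by
    intro l
    rw [← EllTheta.e_int_mul]
    push_cast
    rw [neg_mul]
  have hzpow' : EllTheta.e a₂ ^ (-(n : ℤ)) = EllTheta.e (-(n * a₂)) := by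
    rw [← EllTheta.e_int_mul]
    push_cast
    rw [neg_mul]
  simp only [hpow, hzpow, hzpow', ← EllTheta.e_neg, ← EllTheta.e_add, ← EllTheta.e_nat_mul,
    EllTheta.delta_e]
  refine Eq.trans ?_ (key.trans (congrArg Neg.neg ?_)) <;>
  · refine Finset.sum_congr rfl fun k _ => Finset.sum_congr rfl fun l _ => ?_
    ring
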